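/- Let $d,r\ge 1$ be integers, $I^d=[0,1]^d\subset\mathbb R^d$, let $e_1,\dots,e_d$ be the standard unit vectors, let $|\cdot|$ be the Euclidean norm on $\mathbb{R}^d$ and, for $f\in C(I^d)$, $\|f\|=\max_{I^d}|f|$. Put $$\Delta^r_h f(x)=\sum_{k=0}^r(-1)^{r-k}\binom rk f(x+kh),\qquad \omega^r(f,t)=\sup_{|h|\le t}\ \sup_{x,\,x+rh\in I^d}|\Delta^r_hf(x)|,$$ and, for $n\in\mathbb Z$, $$\Psi_r(f,n)=\sup\bigl\{|\Delta^r_{2^{-n}e_i}f(2^{-n}k)|:\ 1\le i\le d,\ k\in\mathbb Z^d,\ 2^{-n}k,\ 2^{-n}(k+re_i)\in I^d\bigr\}$$ (with $\sup\emptyset=0$). There are finite constants $M_1=M_1(r,d)$, $M_2=M_2(r,d)$ and $M=M(d)$ such that for all $f\in C(I^d)$ and all $n\in\mathbb Z$ (a divergent series being read as $+\infty$): (1.4) $\displaystyle |\Delta^r_{te_i}f(u)|\le M_1\sum_{k=0}^\infty\Psi_r(f,n+k)$ whenever $1\le i\le d$, $0\le t\le 2^{-n}$ and $u,\,u+rte_i\in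 I^d$; (1.5) $\displaystyle \omega^r(f,t)\le M_2\Bigl(\sum_{k=0}^\infty\Psi_r(f,n+k)+\sum_{k=1}^{n_0}2^{-kr}\,\Psi_r(f,n-k)+t^r\|f\|\Bigr)$ whenever $2^{-n-1}<t\le 2^{-n}$, where $n_0$ is the largest integer with $r2^{\,n_0-n-1}\le 1$ (the middle sum is empty if $n_0\le0$); (1.55) $\displaystyle \omega^1(f,t)\le M\sum_{k=0}^\infty\Psi_1(f,n+k)$ whenever $0\le t\le 2^{-n}$. -/

import Mathlib

open scoped NNReal ENNReal

noncomputable section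

/-- The cube `I^d = [0,1]^d` in Euclidean space `ℝ^d`. -/
def unitCube (d : ℕ) : Set (EuclideanSpace ℝ (Fin d)) :=
  {x | ∀ j, x j ∈ Set.Icc (0 : ℝ) 1}

/-- The `r`-th forward difference
`Δ^r_h f(x) = ∑_{k=0}^r (-1)^{r-k} (r choose k) f(x + k h)`. -/
def rDiff {d : ℕ} (r : ℕ) (h : EuclideanSpace ℝ (Fin d))
    (f : EuclideanSpace ℝ (Fin d) → ℝ) (x : EuclideanSpace ℝ (Fin d)) : ℝ :=
  ∑ k ∈ Finset.range (r + 1), (-1 : ℝ) ^ (r - k) * (r.choose k : ℝ) * f (x + (k : ℝ) • h)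

/-- `rDiff` is the `r`-fold iterate of Mathlib's forward difference operator. -/
theorem rDiff_eq_fwdDiff_iterate {d : ℕ} (r : ℕ) (h : EuclideanSpace ℝ (Fin d))
    (f : EuclideanSpace ℝ (Fin d) → ℝ) (x : EuclideanSpace ℝ (Fin d)) :
    rDiff r h f x = (fwdDiff h)^[r] f x := by
  rw [fwdDiff_iter_eq_sum_shift]
  refine Finset.sum_congr rfl fun k _ => ?_
  simp [Nat.cast_smul_eq_nsmul]

/-- The uniform norm `‖f‖` over the cube, as an extended nonnegative real. -/
def cubeNorm {d : ℕ} (f : EuclideanSpace ℝ (Fin d) → ℝ) : ℝ≥0∞ :=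
  ⨆ x ∈ unitCube d, ‖f x‖ₑ

/-- The `r`-th modulus of smoothness `ω^r(f,t)`: the supremum of `|Δ^r_h f(x)|` over all `h` of
Euclidean length at most `t` and all `x` with `x, x + r h ∈ I^d`. -/
def modulus {d : ℕ} (r : ℕ) (f : EuclideanSpace ℝ (Fin d) → ℝ) (t : ℝ) : ℝ≥0∞ :=
  ⨆ (h : EuclideanSpace ℝ (Fin d)) (_ : ‖h‖ ≤ t)
    (x : EuclideanSpace ℝ (Fin d)) (_ : x ∈ unitCube d) (_ : x + (r : ℝ) • h ∈ unitCube d),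
    ‖rDiff r h f x‖ₑ

/-- The unit vector `e_i` in the `i`-th direction. -/
def axis {d : ℕ} (i : Fin d) : EuclideanSpace ℝ (Fin d) := EuclideanSpace.single i (1 : ℝ)

/-- The point `2^{-n} k` of the dyadic mesh, for `k ∈ ℤ^d`. -/
def meshPoint {d : ℕ} (n : ℤ) (k : Fin d → ℤ) : EuclideanSpace ℝ (Fin d) :=
  WithLp.toLp 2 fun j => (2 : ℝ) ^ (-n) * (k j : ℝ)

/-- The discrete `r`-th modulus of smoothness `Ψ_r(f,n)`: the supremum of
`|Δ^r_{2^{-n} e_i} f(2^{-n} k)|` over all `i` and all `k ∈ ℤ^d` with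
`2^{-n} k, 2^{-n} (k + r e_i) ∈ I^d` (zero if there are no such `i`, `k`). -/
def discreteModulus {d : ℕ} (r : ℕ) (f : EuclideanSpace ℝ (Fin d) → ℝ) (n : ℤ) : ℝ≥0∞ :=
  ⨆ (i : Fin d) (k : Fin d → ℤ) (_ : meshPoint n k ∈ unitCube d)
    (_ : meshPoint n (k + Pi.single i (r : ℤ)) ∈ unitCube d),
    ‖rDiff r ((2 : ℝ) ^ (-n) • axis i) f (meshPoint n k)‖ₑ

end

/-! ### Linearity and size of the `r`-th difference -/

/-! Near each point, `f` is compared with the tensor Lagrange interpolant, of degree less than `r`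
in every variable, at a block of `r^d` adjacent mesh points of level `m` (`meshInterp`). The error
vanishes on the block. Axis differences annihilate the interpolant, so those of the error on the
mesh are those of `f`. An end value of an `r`-th difference is controlled by the difference and the
other `r` values, so the error is O(Ψ_r(f,m)) at mesh points a bounded number of cells away
(`exists_abs_sub_meshInterp_le`). Hence nearby interpolants of equal or consecutive levels differ by
O(Ψ_r) of the finer level, at nodes and then, through the Lagrange basis, on comparable boxes.
Refining towards `y` and using continuity of `f`, telescoping gives |f(y) - P_n(y)| ≤ C ∑_k
Ψ_r(f,n+k) (`exists_enorm_sub_meshInterp_le`).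

Up to this tail, differences of `f` with step at most 2^{-n} are those of P_n. Along an axis, and
for `r = 1` in every direction, P_n contributes nothing. Obliquely it does, but on the scale of a
mesh 2^{-m} a step η 2^{-m} gives only O(η^r) (`exists_abs_rDiff_le_of_mesh`). Writing P_n as the
coarsest admissible interpolant plus jumps between consecutive levels, the jumps give the weights
2^{-sr} and the coarsest piece gives t^r‖f‖ (`exists_enorm_rDiff_le`). -/

theorem rDiff_add {d : ℕ} (r : ℕ) (h : EuclideanSpace ℝ (Fin d))
    (f g : EuclideanSpace ℝ (Fin d) → ℝ) (x : EuclideanSpace ℝ (Fin d)) :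
    rDiff r h (f + g) x = rDiff r h f x + rDiff r h g x := by
  simp [rDiff, mul_add, Finset.sum_add_distrib]

theorem rDiff_smul {d : ℕ} (r : ℕ) (h : EuclideanSpace ℝ (Fin d)) (c : ℝ)
    (f : EuclideanSpace ℝ (Fin d) → ℝ) (x : EuclideanSpace ℝ (Fin d)) :
    rDiff r h (c • f) x = c * rDiff r h f x := by
  simp only [rDiff, Finset.mul_sum, Pi.smul_apply, smul_eq_mul]
  exact Finset.sum_congr rfl fun _ _ => by ring

theorem rDiff_sub {d : ℕ} (r : ℕ) (h : EuclideanSpace ℝ (Fin d))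
    (f g : EuclideanSpace ℝ (Fin d) → ℝ) (x : EuclideanSpace ℝ (Fin d)) :
    rDiff r h (f - g) x = rDiff r h f x - rDiff r h g x := by
  simp [rDiff, mul_sub, Finset.sum_sub_distrib]

theorem sum_choose_real (r : ℕ) : ∑ k ∈ Finset.range (r + 1), (r.choose k : ℝ) = 2 ^ r := by
  exact_mod_cast Nat.sum_range_choose r

theorem abs_rDiff_le {d : ℕ} (r : ℕ) (h : EuclideanSpace ℝ (Fin d))
    (f : EuclideanSpace ℝ (Fin d) → ℝ) (x : EuclideanSpace ℝ (Fin d)) (B : ℝ)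
    (hB : ∀ k ≤ r, |f (x + (k : ℝ) • h)| ≤ B) : |rDiff r h f x| ≤ 2 ^ r * B := by
  unfold rDiff
  refine (Finset.abs_sum_le_sum_abs _ _).trans ?_
  rw [← sum_choose_real, Finset.sum_mul]
  refine Finset.sum_le_sum fun k hk => ?_
  rw [abs_mul, abs_mul, abs_pow, abs_neg, abs_one, one_pow, one_mul, Nat.abs_cast]
  exact mul_le_mul_of_nonneg_left (hB k (by simpa [Nat.lt_succ_iff] using hk)) (by positivity)

/-! ### Finite differences of one-variable polynomials -/

theorem sum_choose_eval_eq_zero {r : ℕ} {P : Polynomial ℝ} (hP : P.natDegree < r) :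
    ∑ k ∈ Finset.range (r + 1), (-1 : ℝ) ^ (r - k) * (r.choose k : ℝ) * P.eval (k : ℝ) = 0 := by
  have := congrFun (Polynomial.fwdDiff_iter_eq_zero_of_degree_lt hP) 0
  rw [fwdDiff_iter_eq_sum_shift] at this
  simpa using this

/-- A monomial of degree `j` scales by η^j: for `j < r` its difference vanishes, and for `j ≥ r` one
has η^j ≤ η^r. -/
theorem exists_abs_sum_choose_eval_le (r : ℕ) (P : Polynomial ℝ) :
    ∃ C : ℝ, 0 ≤ C ∧ ∀ η : ℝ, 0 ≤ η → η ≤ 1 →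
      |∑ k ∈ Finset.range (r + 1), (-1 : ℝ) ^ (r - k) * (r.choose k : ℝ) * P.eval (η * k)|
        ≤ C * η ^ r := by
  induction P using Polynomial.induction_on' with
  | add p q hp hq =>
    obtain ⟨C, hC, hp⟩ := hp
    obtain ⟨D, hD, hq⟩ := hq
    refine ⟨C + D, by positivity, fun η h0 h1 => ?_⟩
    simp only [Polynomial.eval_add, mul_add, Finset.sum_add_distrib]
    refine (abs_add_le _ _).trans ?_
    rw [add_mul]
    exact add_le_add (hp η h0 h1) (hq η h0 h1)
  | monomial j a =>
    refine ⟨|∑ k ∈ Finset.range (r + 1), (-1 : ℝ) ^ (r - k) * (r.choose k : ℝ) * (a * k ^ j)|,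
      abs_nonneg _, fun η h0 h1 => ?_⟩
    have key : ∑ k ∈ Finset.range (r + 1), (-1 : ℝ) ^ (r - k) * (r.choose k : ℝ) *
        (Polynomial.monomial j a).eval (η * k) =
        (∑ k ∈ Finset.range (r + 1), (-1 : ℝ) ^ (r - k) * (r.choose k : ℝ) * (a * k ^ j))
          * η ^ j := by
      rw [Finset.sum_mul]
      refine Finset.sum_congr rfl fun k _ => ?_
      rw [Polynomial.eval_monomial, mul_pow]; ring
    rw [key, abs_mul, abs_of_nonneg (pow_nonneg h0 j)]
    rcases lt_or_ge j r with hj | hj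
    · have h2 := sum_choose_eval_eq_zero (r := r) (P := Polynomial.monomial j a)
        ((Polynomial.natDegree_monomial_le a).trans_lt hj)
      simp only [Polynomial.eval_monomial] at h2
      rw [h2]; simp
    · exact mul_le_mul_of_nonneg_left (pow_le_pow_of_le_one h0 h1 hj) (abs_nonneg _)

/-- The Lagrange basis polynomials at the nodes `0, 1, …, r - 1`. -/
noncomputable def natBasis (r : ℕ) (j : Fin r) : Polynomial ℝ :=
  Lagrange.basis Finset.univ (fun i : Fin r => ((i : ℕ) : ℝ)) j

theorem natNodes_injOn (r : ℕ) :
    Set.InjOn (fun i : Fin r => ((i : ℕ) : ℝ)) (Finset.univ : Finset (Fin r)) := by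
  intro a _ b _ h
  exact Fin.ext (Nat.cast_injective (R := ℝ) h)

theorem natBasis_degree_lt (r : ℕ) (j : Fin r) : (natBasis r j).natDegree < r := by
  rw [natBasis, Lagrange.natDegree_basis (natNodes_injOn r) (Finset.mem_univ j)]
  have := j.pos
  simp; omega

theorem natBasis_eval_node (r : ℕ) (j k : Fin r) :
    (natBasis r j).eval ((k : ℕ) : ℝ) = if j = k then 1 else 0 := by
  split_ifs with h
  · subst h
    exact Lagrange.eval_basis_self (natNodes_injOn r) (Finset.mem_univ j)
  · exact Lagrange.eval_basis_of_ne (v := fun i : Fin r => ((i : ℕ) : ℝ)) h (Finset.mem_univ k)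

theorem eval_eq_sum_natBasis {r : ℕ} {P : Polynomial ℝ} (hP : P.natDegree < r)
    (x : ℝ) : P.eval x = ∑ j : Fin r, P.eval ((j : ℕ) : ℝ) * (natBasis r j).eval x := by
  have h : P.degree < (Finset.univ : Finset (Fin r)).card := by
    rw [Finset.card_univ, Fintype.card_fin]
    exact Polynomial.degree_le_natDegree.trans_lt (by exact_mod_cast hP)
  conv_lhs => rw [Lagrange.eq_interpolate (natNodes_injOn r) h, Lagrange.interpolate_apply]
  simp [Polynomial.eval_finsetSum, natBasis]

theorem exists_abs_natBasis_le (r : ℕ) (K : ℝ) :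
    ∃ A : ℝ, 0 ≤ A ∧ ∀ (j : Fin r) (x : ℝ), |x| ≤ K → |(natBasis r j).eval x| ≤ A := by
  have h : ∀ j : Fin r, ∃ A : ℝ, 0 ≤ A ∧ ∀ x : ℝ, |x| ≤ K → |(natBasis r j).eval x| ≤ A := by
    intro j
    obtain ⟨A, hA⟩ := (isCompact_Icc (a := -K) (b := K)).exists_bound_of_continuousOn
      (natBasis r j).continuous.continuousOn
    exact ⟨|A|, abs_nonneg A, fun x hx => (hA x (abs_le.1 hx)).trans (le_abs_self A)⟩
  choose A hA0 hA using h
  refine ⟨∑ j, A j, Finset.sum_nonneg fun j _ => hA0 j, fun j x hx => (hA j x hx).trans ?_⟩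
  exact Finset.single_le_sum (fun j _ => hA0 j) (Finset.mem_univ j)

/-- The polynomial functions of degree less than `r` in each of the `d` variables. -/
noncomputable def coordPoly (d r : ℕ) : Submodule ℝ (EuclideanSpace ℝ (Fin d) → ℝ) :=
  Submodule.span ℝ {q | ∃ P : Fin d → Polynomial ℝ, (∀ i, (P i).natDegree < r) ∧
    q = fun z => ∏ i, (P i).eval (z i)}

/-- The point of `ℝ^d` with the coordinates `j i`, `0 ≤ j i < r`. -/
noncomputable def nodePoint {d r : ℕ} (j : Fin d → Fin r) : EuclideanSpace ℝ (Fin d) :=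
  WithLp.toLp 2 fun i => ((j i : ℕ) : ℝ)

/-- Tensor product Lagrange interpolation at the nodes `{0, …, r - 1}^d`. -/
noncomputable def tensorInterp {d r : ℕ} (g : (Fin d → Fin r) → ℝ) :
    EuclideanSpace ℝ (Fin d) → ℝ :=
  fun z => ∑ j, g j * ∏ i, (natBasis r (j i)).eval (z i)

theorem tensorInterp_mem {d r : ℕ} (g : (Fin d → Fin r) → ℝ) :
    tensorInterp g ∈ coordPoly d r := by
  have : tensorInterp g = ∑ j, g j • fun z : EuclideanSpace ℝ (Fin d) =>
      ∏ i, (natBasis r (j i)).eval (z i) := by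
    ext z; simp [tensorInterp]
  rw [this]
  refine Submodule.sum_mem _ fun j _ => Submodule.smul_mem _ _ (Submodule.subset_span ?_)
  exact ⟨fun i => natBasis r (j i), fun i => natBasis_degree_lt _ _, rfl⟩

theorem tensorInterp_node {d r : ℕ} (g : (Fin d → Fin r) → ℝ) (j : Fin d → Fin r) :
    tensorInterp g (nodePoint j) = g j := by
  rw [tensorInterp, Finset.sum_eq_single j]
  · simp [nodePoint, natBasis_eval_node]
  · intro k _ hk
    obtain ⟨i, hi⟩ := Function.ne_iff.1 hk
    rw [Finset.prod_eq_zero (Finset.mem_univ i), mul_zero]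
    simp [nodePoint, natBasis_eval_node, hi]
  · simp

/-- For a product of one-variable polynomials, each factor is reproduced by Lagrange interpolation
and the product of sums is expanded; the rest is linearity. -/
theorem coordPoly_eq_tensorInterp {d r : ℕ} {q : EuclideanSpace ℝ (Fin d) → ℝ}
    (hq : q ∈ coordPoly d r) : q = tensorInterp fun j : Fin d → Fin r => q (nodePoint j) := by
  induction hq using Submodule.span_induction with
  | mem q hq =>
    obtain ⟨P, hP, rfl⟩ := hq
    ext z
    simp only [tensorInterp]
    rw [Finset.prod_congr rfl fun i _ => eval_eq_sum_natBasis (hP i) (z i),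
      Finset.prod_univ_sum, Fintype.piFinset_univ]
    refine Finset.sum_congr rfl fun j _ => ?_
    rw [Finset.prod_mul_distrib]; rfl
  | zero => ext z; simp [tensorInterp]
  | add p q _ _ hp hq =>
    ext z
    rw [Pi.add_apply, congrFun hp z, congrFun hq z]
    simp [tensorInterp, add_mul, Finset.sum_add_distrib]
  | smul c p _ hp =>
    ext z
    rw [Pi.smul_apply, congrFun hp z]
    simp [tensorInterp, Finset.mul_sum, mul_assoc]

theorem coordPoly_comp_affine {d r : ℕ} {q : EuclideanSpace ℝ (Fin d) → ℝ}
    (hq : q ∈ coordPoly d r) (c : EuclideanSpace ℝ (Fin d)) (a : ℝ) :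
    (fun z => q (c + a • z)) ∈ coordPoly d r := by
  induction hq using Submodule.span_induction with
  | mem q hq =>
    obtain ⟨P, hP, rfl⟩ := hq
    refine Submodule.subset_span
      ⟨fun i => (P i).comp (Polynomial.C (c i) + Polynomial.C a * Polynomial.X), fun i => ?_, ?_⟩
    · refine lt_of_le_of_lt (Polynomial.natDegree_comp_le.trans ?_) (hP i)
      refine (Nat.mul_le_mul_left _ (m := 1) ?_).trans (by simp)
      compute_degree
    · ext z; simp
  | zero => exact Submodule.zero_mem _
  | add p q _ _ hp hq => exact Submodule.add_mem _ hp hq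
  | smul c p _ hp => exact Submodule.smul_mem _ c hp

theorem continuous_of_mem_coordPoly {d r : ℕ} {q : EuclideanSpace ℝ (Fin d) → ℝ}
    (hq : q ∈ coordPoly d r) : Continuous q := by
  induction hq using Submodule.span_induction with
  | mem q hq =>
    obtain ⟨P, hP, rfl⟩ := hq
    exact continuous_finsetProd _ fun i _ => (P i).continuous.comp (by fun_prop)
  | zero => exact continuous_const
  | add p q _ _ hp hq => exact hp.add hq
  | smul c p _ hp => exact hp.const_smul c

/-- Along an axis only one factor of a product varies, and it has degree less than `r`. -/
theorem rDiff_axis_eq_zero {d r : ℕ} {q : EuclideanSpace ℝ (Fin d) → ℝ}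
    (hq : q ∈ coordPoly d r) (t : ℝ) (i : Fin d) (x : EuclideanSpace ℝ (Fin d)) :
    rDiff r (t • axis i) q x = 0 := by
  induction hq using Submodule.span_induction with
  | mem q hq =>
    obtain ⟨P, hP, rfl⟩ := hq
    have h1 : ((P i).comp (Polynomial.C (x i) + Polynomial.C t * Polynomial.X)).natDegree < r := by
      refine lt_of_le_of_lt (Polynomial.natDegree_comp_le.trans ?_) (hP i)
      refine (Nat.mul_le_mul_left _ (m := 1) ?_).trans (by simp)
      compute_degree
    have h2 := congrArg (fun s : ℝ => s * ∏ j ∈ Finset.univ.erase i, (P j).eval (x j))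
      (sum_choose_eval_eq_zero h1)
    simp only [zero_mul, Finset.sum_mul] at h2
    rw [← h2]
    refine Finset.sum_congr rfl fun k _ => ?_
    beta_reduce
    rw [← Finset.mul_prod_erase _ _ (Finset.mem_univ i), mul_assoc (_ * _)]
    congr 2
    · simp [axis]
      rw [mul_comm]
    · refine Finset.prod_congr rfl fun j hj => ?_
      simp [axis, Finset.ne_of_mem_erase hj]
  | zero => simp [rDiff]
  | add p q _ _ hp hq => rw [rDiff_add, hp, hq, add_zero]
  | smul c p _ hp => rw [rDiff_smul, hp, mul_zero]

theorem coordPoly_one_const {d : ℕ} {q : EuclideanSpace ℝ (Fin d) → ℝ}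
    (hq : q ∈ coordPoly d 1) (x y : EuclideanSpace ℝ (Fin d)) : q x = q y := by
  induction hq using Submodule.span_induction with
  | mem q hq =>
    obtain ⟨P, hP, rfl⟩ := hq
    refine Finset.prod_congr rfl fun i _ => ?_
    rw [Polynomial.eq_C_of_natDegree_eq_zero (Nat.lt_one_iff.1 (hP i))]
    simp
  | zero => rfl
  | add p q _ _ hp hq => simp [hp, hq]
  | smul c p _ hp => simp [hp]

/-- On an oblique line the degree may reach `r` or more, so differences need not vanish; a degree
bound independent of the line still yields uniform estimates. -/
theorem exists_line_polynomial {d r : ℕ} {q : EuclideanSpace ℝ (Fin d) → ℝ}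
    (hq : q ∈ coordPoly d r) (z v : EuclideanSpace ℝ (Fin d)) :
    ∃ R : Polynomial ℝ, R.natDegree ≤ d * r ∧ ∀ s : ℝ, R.eval s = q (z + s • v) := by
  induction hq using Submodule.span_induction with
  | mem q hq =>
    obtain ⟨P, hP, rfl⟩ := hq
    refine ⟨∏ i, (P i).comp (Polynomial.C (z i) + Polynomial.C (v i) * Polynomial.X), ?_, ?_⟩
    · refine (Polynomial.natDegree_prod_le _ _).trans ?_
      have : ∀ i ∈ (Finset.univ : Finset (Fin d)), ((P i).comp
          (Polynomial.C (z i) + Polynomial.C (v i) * Polynomial.X)).natDegree ≤ r := by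
        intro i _
        refine (Polynomial.natDegree_comp_le.trans ?_).trans (hP i).le
        refine (Nat.mul_le_mul_left _ (m := 1) ?_).trans (by simp)
        compute_degree
      simpa using Finset.sum_le_card_nsmul _ _ _ this
    · intro s
      simp [Polynomial.eval_prod]
      exact Finset.prod_congr rfl fun i _ => by rw [mul_comm]
  | zero => exact ⟨0, by simp, by simp⟩
  | add p q _ _ hp hq =>
    obtain ⟨R, hR, hp⟩ := hp
    obtain ⟨S, hS, hq⟩ := hq
    exact ⟨R + S, (Polynomial.natDegree_add_le _ _).trans (max_le hR hS), fun s => by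
      rw [Polynomial.eval_add, hp, hq]; rfl⟩
  | smul c p _ hp =>
    obtain ⟨R, hR, hp⟩ := hp
    exact ⟨c • R, (Polynomial.natDegree_smul_le _ _).trans hR, fun s => by
      rw [Polynomial.eval_smul, hp]; rfl⟩

/-- A polynomial of degree less than `r` in each variable is controlled on boxes by its values at
the nodes. -/
theorem exists_abs_le_of_nodes {d r : ℕ} (K : ℝ) :
    ∃ C : ℝ, 0 ≤ C ∧ ∀ q ∈ coordPoly d r, ∀ B : ℝ,
      (∀ j : Fin d → Fin r, |q (nodePoint j)| ≤ B) →
      ∀ z : EuclideanSpace ℝ (Fin d), (∀ i, |z i| ≤ K) → |q z| ≤ C * B := by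
  obtain ⟨A, hA0, hA⟩ := exists_abs_natBasis_le r K
  refine ⟨(Fintype.card (Fin d → Fin r)) * A ^ d, by positivity, fun q hq B hB z hz => ?_⟩
  rw [congrFun (coordPoly_eq_tensorInterp hq) z, tensorInterp]
  refine (Finset.abs_sum_le_sum_abs _ _).trans ?_
  refine (Finset.sum_le_card_nsmul _ _ (B * A ^ d) fun j _ => ?_).trans ?_
  · have h0 : 0 ≤ B := (abs_nonneg _).trans (hB j)
    rw [abs_mul, Finset.abs_prod]
    refine mul_le_mul (hB j) ?_ (by positivity) h0
    exact (Finset.prod_le_prod (fun i _ => abs_nonneg _) fun i _ => hA (j i) _ (hz i)).trans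
      (by simp)
  · rw [Finset.card_univ, nsmul_eq_mul]
    exact le_of_eq (by ring)

/-- Restricted to the line in direction `η⁻¹ • h`, `q` becomes a polynomial of degree less than `D`,
and the step becomes η. Expanding it in the Lagrange basis at `0, …, D - 1` reduces the claim to the
η^r bound for finitely many fixed polynomials. -/
theorem exists_abs_rDiff_le_of_nodes {d r : ℕ} (K : ℝ) :
    ∃ C : ℝ, 0 ≤ C ∧ ∀ q ∈ coordPoly d r, ∀ B : ℝ,
      (∀ j : Fin d → Fin r, |q (nodePoint j)| ≤ B) →
      ∀ z h : EuclideanSpace ℝ (Fin d), ∀ η : ℝ, 0 < η → η ≤ 1 → (∀ i, |z i| ≤ K) →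
        (∀ i, |h i| ≤ η) → |rDiff r h q z| ≤ C * η ^ r * B := by
  set D := d * r + 1 with hD
  -- Since |η⁻¹ h_i| ≤ 1, the `D` nodes on the line stay in the box of radius `K + D`.
  obtain ⟨C, hC0, hC⟩ := exists_abs_le_of_nodes (d := d) (r := r) (K + D)
  choose A hA0 hA using fun j : Fin D => exists_abs_sum_choose_eval_le r (natBasis D j)
  refine ⟨C * ∑ j, A j, mul_nonneg hC0 (Finset.sum_nonneg fun j _ => hA0 j),
    fun q hq B hB z h η h0 h1 hz hh => ?_⟩
  obtain ⟨R, hR, hRq⟩ := exists_line_polynomial hq z (η⁻¹ • h)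
  have hnode : ∀ j : Fin D, |R.eval ((j : ℕ) : ℝ)| ≤ C * B := by
    intro j
    rw [hRq]
    refine hC q hq B hB _ fun i => ?_
    have h2 : |η⁻¹ * h i| ≤ 1 := by
      rw [abs_mul, abs_of_pos (inv_pos.2 h0), inv_mul_le_iff₀ h0, mul_one]; exact hh i
    have h3 : ((j : ℕ) : ℝ) ≤ D := by exact_mod_cast j.2.le
    simp only [PiLp.add_apply, PiLp.smul_apply, smul_eq_mul]
    refine (abs_add_le _ _).trans (add_le_add (hz i) ?_)
    rw [abs_mul, Nat.abs_cast]
    exact (mul_le_of_le_one_right (by positivity) h2).trans h3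
  have hsum : rDiff r h q z = ∑ j : Fin D, R.eval ((j : ℕ) : ℝ) *
      ∑ k ∈ Finset.range (r + 1), (-1 : ℝ) ^ (r - k) * (r.choose k : ℝ) *
        (natBasis D j).eval (η * k) := by
    simp only [Finset.mul_sum]
    rw [Finset.sum_comm]
    refine Finset.sum_congr rfl fun k _ => ?_
    have : q (z + (k : ℝ) • h) = R.eval (η * k) := by
      rw [hRq, smul_smul, mul_right_comm, mul_inv_cancel₀ h0.ne', one_mul]
    rw [this, eval_eq_sum_natBasis (r := D) (by omega), Finset.mul_sum]
    exact Finset.sum_congr rfl fun j _ => by ring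
  rw [hsum]
  refine (Finset.abs_sum_le_sum_abs _ _).trans ?_
  have : C * (∑ j, A j) * η ^ r * B = ∑ j, C * B * (A j * η ^ r) := by
    rw [← Finset.mul_sum, ← Finset.sum_mul]; ring
  rw [this]
  refine Finset.sum_le_sum fun j _ => ?_
  rw [abs_mul]
  exact mul_le_mul (hnode j) (hA j η h0.le h1) (abs_nonneg _) ((abs_nonneg _).trans (hnode j))

/-- Affine rescaling carries the standard nodes to a mesh block and preserves `coordPoly`, so the
constant depends on neither the level nor the block. -/
theorem exists_abs_le_of_mesh {d r : ℕ} (K : ℝ) :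
    ∃ C : ℝ, 0 ≤ C ∧ ∀ q ∈ coordPoly d r, ∀ (B : ℝ) (n : ℤ) (b : Fin d → ℤ),
      (∀ j : Fin d → Fin r, |q (meshPoint n fun i => b i + (j i : ℕ))| ≤ B) →
      ∀ z : EuclideanSpace ℝ (Fin d), (∀ i, |z i - (2 : ℝ) ^ (-n) * b i| ≤ K * (2 : ℝ) ^ (-n)) → |q z| ≤ C * B := by
  obtain ⟨C, hC0, hC⟩ := exists_abs_le_of_nodes (d := d) (r := r) K
  refine ⟨C, hC0, fun q hq B n b hB z hz => ?_⟩
  obtain ⟨a, ha', ha⟩ : ∃ a : ℝ, a = (2 : ℝ) ^ (-n) ∧ 0 < a := ⟨_, rfl, by positivity⟩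
  simp only [← ha'] at hz
  have := hC _ (coordPoly_comp_affine hq (meshPoint n b) a) B (fun j => ?_)
    (a⁻¹ • (z - meshPoint n b)) fun i => ?_
  · simpa [smul_smul, ha.ne'] using this
  · convert hB j using 3
    ext i; simp [meshPoint, nodePoint, mul_add, ha']
  · simp only [PiLp.smul_apply, PiLp.sub_apply, smul_eq_mul, meshPoint, ← ha']
    rw [abs_mul, abs_of_pos (inv_pos.2 ha), inv_mul_le_iff₀ ha, mul_comm a K]
    exact hz i

theorem exists_abs_rDiff_le_of_mesh {d r : ℕ} (K : ℝ) :
    ∃ C : ℝ, 0 ≤ C ∧ ∀ q ∈ coordPoly d r, ∀ (B : ℝ) (n : ℤ) (b : Fin d → ℤ),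
      (∀ j : Fin d → Fin r, |q (meshPoint n fun i => b i + (j i : ℕ))| ≤ B) →
      ∀ z h : EuclideanSpace ℝ (Fin d), ∀ η : ℝ, 0 < η → η ≤ 1 →
        (∀ i, |z i - (2 : ℝ) ^ (-n) * b i| ≤ K * (2 : ℝ) ^ (-n)) → (∀ i, |h i| ≤ η * (2 : ℝ) ^ (-n)) →
        |rDiff r h q z| ≤ C * η ^ r * B := by
  obtain ⟨C, hC0, hC⟩ := exists_abs_rDiff_le_of_nodes (d := d) (r := r) K
  refine ⟨C, hC0, fun q hq B n b hB z h η h0 h1 hz hh => ?_⟩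
  obtain ⟨a, ha', ha⟩ : ∃ a : ℝ, a = (2 : ℝ) ^ (-n) ∧ 0 < a := ⟨_, rfl, by positivity⟩
  simp only [← ha'] at hz hh
  have := hC _ (coordPoly_comp_affine hq (meshPoint n b) a) B (fun j => ?_)
    (a⁻¹ • (z - meshPoint n b)) (a⁻¹ • h) η h0 h1 (fun i => ?_) fun i => ?_
  · convert this using 2
    refine Finset.sum_congr rfl fun k _ => ?_
    congr 2
    rw [smul_add, smul_comm _ a⁻¹ h, smul_smul, smul_smul, mul_inv_cancel₀ ha.ne', one_smul,
      one_smul]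
    abel
  · convert hB j using 3
    ext i; simp [meshPoint, nodePoint, mul_add, ha']
  · simp only [PiLp.smul_apply, PiLp.sub_apply, smul_eq_mul, meshPoint, ← ha']
    rw [abs_mul, abs_of_pos (inv_pos.2 ha), inv_mul_le_iff₀ ha, mul_comm a K]
    exact hz i
  · simp only [PiLp.smul_apply, smul_eq_mul]
    rw [abs_mul, abs_of_pos (inv_pos.2 ha), inv_mul_le_iff₀ ha, mul_comm a η]
    exact hh i

/-! ### Propagation of bounds by finite differences on the integer lattice -/

/-- The last value has coefficient 1, and the other coefficients have absolute sum 2^r - 1. -/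
theorem abs_last_le_of_sum_choose {r : ℕ} {a : ℕ → ℝ} {X : ℝ}
    (h : |∑ j ∈ Finset.range (r + 1), (-1 : ℝ) ^ (r - j) * (r.choose j : ℝ) * a j| ≤ X)
    (ha : ∀ j < r, |a j| ≤ X) : |a r| ≤ 2 ^ r * X := by
  have hs := sum_choose_real r
  rw [Finset.sum_range_succ] at h hs
  have h2 : |∑ j ∈ Finset.range r, (-1 : ℝ) ^ (r - j) * (r.choose j : ℝ) * a j|
      ≤ (∑ j ∈ Finset.range r, (r.choose j : ℝ)) * X := by
    rw [Finset.sum_mul]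
    refine (Finset.abs_sum_le_sum_abs _ _).trans (Finset.sum_le_sum fun j hj => ?_)
    rw [abs_mul, abs_mul, abs_pow, abs_neg, abs_one, one_pow, one_mul, Nat.abs_cast]
    exact mul_le_mul_of_nonneg_left (ha j (Finset.mem_range.1 hj)) (by positivity)
  simp only [Nat.sub_self, pow_zero, Nat.choose_self, Nat.cast_one, one_mul] at h hs
  rw [← hs, add_mul, one_mul]
  rw [abs_le] at *
  constructor <;> linarith

/-- Reversing the order of the values changes an `r`-th difference only by the sign (-1)^r. -/
theorem abs_first_le_of_sum_choose {r : ℕ} {a : ℕ → ℝ} {X : ℝ}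
    (h : |∑ j ∈ Finset.range (r + 1), (-1 : ℝ) ^ (r - j) * (r.choose j : ℝ) * a j| ≤ X)
    (ha : ∀ j < r, |a (j + 1)| ≤ X) : |a 0| ≤ 2 ^ r * X := by
  refine abs_last_le_of_sum_choose (a := fun j => a (r - j)) ?_ ?_ |>.trans_eq' (by simp)
  · rw [← Finset.sum_range_reflect] at h
    have h2 : |(-1 : ℝ) ^ r * ∑ j ∈ Finset.range (r + 1),
        (-1 : ℝ) ^ (r - j) * (r.choose j : ℝ) * a (r - j)| ≤ X := by
      convert h using 2
      rw [Finset.mul_sum]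
      refine Finset.sum_congr rfl fun j hj => ?_
      have hj : j ≤ r := by simpa [Nat.lt_succ_iff] using hj
      obtain ⟨l, rfl⟩ := Nat.exists_eq_add_of_le hj
      have h3 : j + l + 1 - 1 - j = l := by omega
      have h4 : j + l - l = j := by omega
      have h5 : j + l - j = l := by omega
      rw [h3, h4, h5, Nat.choose_symm_add, pow_add]
      have : ((-1 : ℝ) ^ l) * (-1) ^ l = 1 := by rw [← mul_pow]; simp
      linear_combination ((-1) ^ j * ((j + l).choose l : ℝ) * a l) * this
    simpa [abs_mul] using h2
  · intro j hj
    have := ha (r - j - 1) (by omega)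
    rwa [show r - j - 1 + 1 = r - j by omega] at this

/-- A window of `r` consecutive bounded values grows by one place on each side per step, at the cost
of a factor 2^r. -/
theorem abs_le_of_differences {r : ℕ} {g : ℤ → ℝ} {b N : ℤ} {B : ℝ} (hb : 0 ≤ b)
    (hbN : b + r ≤ N) (hB : 0 ≤ B)
    (hd : ∀ k : ℤ, 0 ≤ k → k + r ≤ N →
      |∑ j ∈ Finset.range (r + 1), (-1 : ℝ) ^ (r - j) * (r.choose j : ℝ) * g (k + j)| ≤ B)
    (hg : ∀ k : ℤ, b ≤ k → k < b + r → |g k| ≤ B) (e : ℕ) :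
    ∀ k : ℤ, 0 ≤ k → k ≤ N → b - e ≤ k → k < b + r + e → |g k| ≤ (2 ^ r) ^ e * B := by
  have hone : (1 : ℝ) ≤ 2 ^ r := one_le_pow₀ (by norm_num)
  induction e with
  | zero =>
    intro k _ _ h1 h2
    simpa using hg k (by simpa using h1) (by simpa using h2)
  | succ e ih =>
    intro k h0 hN h1 h2
    push_cast at h1 h2
    have hX : B ≤ (2 ^ r) ^ e * B := le_mul_of_one_le_left hB (one_le_pow₀ hone)
    rw [pow_succ', mul_assoc]
    rcases lt_trichotomy k (b - e) with h | h | h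
    · have hk : k + r ≤ N := by omega
      have := abs_first_le_of_sum_choose (a := fun j => g (k + j)) ((hd k h0 hk).trans hX) ?_
      · simpa using this
      · intro j hj
        exact ih _ (by omega) (by omega) (by push_cast; omega) (by push_cast; omega)
    · by_cases h3 : k < b + r + e
      · exact (ih k h0 hN h.ge h3).trans (le_mul_of_one_le_left (hB.trans hX) hone)
      · have := abs_last_le_of_sum_choose (a := fun j => g (k - r + j))
          ((hd (k - r) (by omega) (by omega)).trans hX) ?_
        · simpa using this
        · intro j hj
          exact ih _ (by omega) (by omega) (by omega) (by omega)
    · by_cases h3 : k < b + r + e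
      · exact (ih k h0 hN h.le h3).trans (le_mul_of_one_le_left (hB.trans hX) hone)
      · have := abs_last_le_of_sum_choose (a := fun j => g (k - r + j))
          ((hd (k - r) (by omega) (by omega)).trans hX) ?_
        · simpa using this
        · intro j hj
          exact ih _ (by omega) (by omega) (by omega) (by omega)

theorem abs_le_of_coordinate_differences {d r : ℕ} {g : (Fin d → ℤ) → ℝ} {b : Fin d → ℤ} {N : ℤ}
    {B : ℝ} (hb : ∀ i, 0 ≤ b i) (hbN : ∀ i, b i + r ≤ N) (hB : 0 ≤ B)
    (hd : ∀ (i : Fin d) (k : Fin d → ℤ), (∀ l, 0 ≤ k l ∧ k l ≤ N) → k i + r ≤ N →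
      |∑ j ∈ Finset.range (r + 1), (-1 : ℝ) ^ (r - j) * (r.choose j : ℝ) *
        g (Function.update k i (k i + j))| ≤ B)
    (hg : ∀ k : Fin d → ℤ, (∀ i, b i ≤ k i ∧ k i < b i + r) → |g k| ≤ B) (e : ℕ)
    (k : Fin d → ℤ) (hk : ∀ i, 0 ≤ k i ∧ k i ≤ N) (hke : ∀ i, b i - e ≤ k i ∧ k i < b i + r + e) :
    |g k| ≤ ((2 ^ r) ^ e) ^ d * B := by
  have hone : (1 : ℝ) ≤ (2 ^ r) ^ e := one_le_pow₀ (one_le_pow₀ (by norm_num))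
  -- `S` is the set of coordinates allowed to leave the initial window; each costs one application
  -- of the one-dimensional bound.
  have main : ∀ S : Finset (Fin d), ∀ k : Fin d → ℤ, (∀ i, 0 ≤ k i ∧ k i ≤ N) →
      (∀ i, b i - e ≤ k i ∧ k i < b i + r + e) → (∀ i, i ∉ S → b i ≤ k i ∧ k i < b i + r) →
      |g k| ≤ ((2 ^ r) ^ e) ^ S.card * B := by
    intro S
    induction S using Finset.induction_on with
    | empty => exact fun k _ _ h => by simpa using hg k fun i => h i (by simp)
    | insert i S hi ih =>
      intro k hk hke hkS
      rw [Finset.card_insert_of_notMem hi, pow_succ', mul_assoc]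
      have hX : B ≤ ((2 ^ r) ^ e) ^ S.card * B := le_mul_of_one_le_left hB (one_le_pow₀ hone)
      have hbox : ∀ s : ℤ, 0 ≤ s → s ≤ N → ∀ l, 0 ≤ Function.update k i s l ∧
          Function.update k i s l ≤ N := by
        intro s h0 h1 l
        rcases eq_or_ne l i with rfl | hl
        · simp [h0, h1]
        · simpa [hl] using hk l
      have := abs_le_of_differences (g := fun s => g (Function.update k i s)) (hb i) (hbN i)
        (hB.trans hX) (fun s h0 hs => ?_) (fun s h0 hs => ?_) e (k i) (hk i).1 (hk i).2
        (hke i).1 (hke i).2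
      · simpa using this
      · have h3 := hd i (Function.update k i s) (hbox s h0 (by omega)) (by simpa using hs)
        simp only [Function.update_self, Function.update_idem] at h3
        exact h3.trans hX
      · have := hb i
        have := hbN i
        refine ih _ (hbox s (by omega) (by omega)) (fun l => ?_) fun l hl => ?_
        · rcases eq_or_ne l i with rfl | hl
          · simp; omega
          · simpa [hl] using hke l
        · rcases eq_or_ne l i with rfl | hli
          · simp [h0, hs]
          · simpa [hli] using hkS l (by simp [hli, hl])
  simpa using main Finset.univ k hk hke (by simp)

/-! ### Mesh points and the discrete modulus -/

theorem meshPoint_mem_unitCube {d : ℕ} {m : ℕ} {k : Fin d → ℤ}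
    (hk : ∀ i, 0 ≤ k i ∧ k i ≤ 2 ^ m) : meshPoint (m : ℤ) k ∈ unitCube d := by
  intro i
  have h0 : (0 : ℝ) ≤ k i := by exact_mod_cast (hk i).1
  have h1 : (k i : ℝ) ≤ 2 ^ m := by exact_mod_cast (hk i).2
  simp only [meshPoint, zpow_neg, zpow_natCast, Set.mem_Icc]
  refine ⟨by positivity, ?_⟩
  rwa [inv_mul_le_iff₀ (by positivity), mul_one]

theorem meshPoint_add_smul_axis {d : ℕ} (n : ℤ) (k : Fin d → ℤ) (i : Fin d) (j : ℕ) :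
    meshPoint n k + (j : ℝ) • (2 : ℝ) ^ (-n) • axis i
      = meshPoint n (Function.update k i (k i + j)) := by
  ext l
  rcases eq_or_ne l i with rfl | hl
  · simp [meshPoint, axis]; ring
  · simp [meshPoint, axis, hl]

theorem unitCube_convex (d : ℕ) : Convex ℝ (unitCube d) := by
  intro x hx y hy a b ha hb hab i
  exact convex_Icc (0 : ℝ) 1 (hx i) (hy i) ha hb hab

theorem isCompact_unitCube (d : ℕ) : IsCompact (unitCube d) := by
  have h : unitCube d = (EuclideanSpace.equiv (Fin d) ℝ).toHomeomorph ⁻¹'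
      (Set.univ.pi fun _ => Set.Icc (0 : ℝ) 1) := by
    ext x
    exact ⟨fun h i _ => h i, fun h i => h i trivial⟩
  rw [h, Homeomorph.isCompact_preimage]
  exact isCompact_univ_pi fun _ => isCompact_Icc

theorem add_smul_mem_unitCube {d r : ℕ} {x h : EuclideanSpace ℝ (Fin d)} (hx : x ∈ unitCube d)
    (hxh : x + (r : ℝ) • h ∈ unitCube d) {k : ℕ} (hk : k ≤ r) :
    x + (k : ℝ) • h ∈ unitCube d := by
  rcases Nat.eq_zero_or_pos r with rfl | hr
  · obtain rfl : k = 0 := by omega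
    simpa using hx
  have hr' : (0 : ℝ) < r := by exact_mod_cast hr
  have := (unitCube_convex d).add_smul_mem hx hxh (t := (k : ℝ) / r)
    ⟨by positivity, (div_le_one hr').2 (by exact_mod_cast hk)⟩
  rwa [smul_smul, div_mul_cancel₀ _ hr'.ne'] at this

theorem exists_abs_le_unitCube {d : ℕ} {f : EuclideanSpace ℝ (Fin d) → ℝ}
    (hf : ContinuousOn f (unitCube d)) : ∃ A : ℝ, ∀ x ∈ unitCube d, |f x| ≤ A :=
  (isCompact_unitCube d).exists_bound_of_continuousOn hf

theorem cubeNorm_ne_top {d : ℕ} {f : EuclideanSpace ℝ (Fin d) → ℝ}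
    (hf : ContinuousOn f (unitCube d)) : cubeNorm f ≠ ⊤ := by
  obtain ⟨A, hA⟩ := exists_abs_le_unitCube hf
  refine ne_top_of_le_ne_top ENNReal.ofReal_ne_top (iSup₂_le fun x hx => ?_ :
    cubeNorm f ≤ ENNReal.ofReal A)
  rw [Real.enorm_eq_ofReal_abs]
  exact ENNReal.ofReal_le_ofReal (hA x hx)

theorem abs_le_cubeNorm {d : ℕ} {f : EuclideanSpace ℝ (Fin d) → ℝ}
    (hf : ContinuousOn f (unitCube d)) {x : EuclideanSpace ℝ (Fin d)} (hx : x ∈ unitCube d) :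
    |f x| ≤ (cubeNorm f).toReal := by
  rw [← ENNReal.ofReal_le_iff_le_toReal (cubeNorm_ne_top hf), ← Real.enorm_eq_ofReal_abs]
  exact le_iSup₂_of_le x hx le_rfl

theorem abs_rDiff_le_cubeNorm {d r : ℕ} {f : EuclideanSpace ℝ (Fin d) → ℝ}
    (hf : ContinuousOn f (unitCube d)) {x h : EuclideanSpace ℝ (Fin d)} (hx : x ∈ unitCube d)
    (hxh : x + (r : ℝ) • h ∈ unitCube d) : |rDiff r h f x| ≤ 2 ^ r * (cubeNorm f).toReal :=
  abs_rDiff_le _ _ _ _ _ fun _ hk => abs_le_cubeNorm hf (add_smul_mem_unitCube hx hxh hk)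

theorem discreteModulus_ne_top {d r : ℕ} {f : EuclideanSpace ℝ (Fin d) → ℝ}
    (hf : ContinuousOn f (unitCube d)) (n : ℤ) : discreteModulus r f n ≠ ⊤ := by
  refine ne_top_of_le_ne_top ENNReal.ofReal_ne_top
    (iSup_le fun i => iSup_le fun k => iSup₂_le fun h1 h2 => ?_ :
    discreteModulus r f n ≤ ENNReal.ofReal (2 ^ r * (cubeNorm f).toReal))
  rw [Real.enorm_eq_ofReal_abs]
  refine ENNReal.ofReal_le_ofReal (abs_rDiff_le_cubeNorm hf h1 ?_)
  convert h2 using 1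
  rw [meshPoint_add_smul_axis]
  congr 1
  ext l
  rcases eq_or_ne l i with rfl | hl
  · simp
  · simp [hl]

theorem abs_rDiff_le_discreteModulus {d r m : ℕ} {f : EuclideanSpace ℝ (Fin d) → ℝ}
    (hf : ContinuousOn f (unitCube d)) (i : Fin d) (k : Fin d → ℤ)
    (hk : ∀ l, 0 ≤ k l ∧ k l ≤ 2 ^ m) (hki : k i + r ≤ 2 ^ m) :
    |rDiff r ((2 : ℝ) ^ (-(m : ℤ)) • axis i) f (meshPoint m k)|
      ≤ (discreteModulus r f m).toReal := by
  rw [← ENNReal.ofReal_le_iff_le_toReal (discreteModulus_ne_top hf m), ← Real.enorm_eq_ofReal_abs]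
  refine le_iSup_of_le i (le_iSup_of_le k (le_iSup₂_of_le (meshPoint_mem_unitCube hk)
    (meshPoint_mem_unitCube fun l => ?_) le_rfl))
  have := hk l
  rcases eq_or_ne l i with rfl | hl
  · simp; omega
  · simpa [hl] using hk l

/-! ### Local interpolants on the dyadic meshes -/

/-- The polynomial of degree less than `r` in each variable that agrees with `f` at the points
`2^{-m}(a + j)`, `j ∈ {0, …, r - 1}^d`. -/
noncomputable def meshInterp {d : ℕ} (r : ℕ) (f : EuclideanSpace ℝ (Fin d) → ℝ) (m : ℕ)
    (a : Fin d → ℤ) : EuclideanSpace ℝ (Fin d) → ℝ :=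
  fun y => tensorInterp (fun j : Fin d → Fin r => f (meshPoint m fun i => a i + (j i : ℕ)))
    (-meshPoint 0 a + (2 : ℝ) ^ m • y)

theorem meshInterp_mem {d : ℕ} (r : ℕ) (f : EuclideanSpace ℝ (Fin d) → ℝ) (m : ℕ)
    (a : Fin d → ℤ) : meshInterp r f m a ∈ coordPoly d r :=
  coordPoly_comp_affine (tensorInterp_mem _) _ _

theorem meshInterp_node {d r : ℕ} (f : EuclideanSpace ℝ (Fin d) → ℝ) (m : ℕ)
    (a : Fin d → ℤ) (j : Fin d → Fin r) :
    meshInterp r f m a (meshPoint m fun i => a i + (j i : ℕ))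
      = f (meshPoint m fun i => a i + (j i : ℕ)) := by
  rw [meshInterp]
  convert tensorInterp_node _ j using 2
  ext i
  simp [meshPoint, nodePoint]

theorem meshInterp_of_lt {d r : ℕ} (f : EuclideanSpace ℝ (Fin d) → ℝ) (m : ℕ)
    {a k : Fin d → ℤ} (hk : ∀ i, a i ≤ k i ∧ k i < a i + r) :
    meshInterp r f m a (meshPoint m k) = f (meshPoint m k) := by
  have : k = fun i => a i + (((⟨(k i - a i).toNat, by have := hk i; omega⟩ : Fin r) : ℕ) : ℤ) := by
    ext i
    have := hk i
    simp only []
    omega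
  rw [this]
  exact meshInterp_node f m a _

/-- The error is zero on the block, and its axis differences equal those of `f`, so the bound
propagates from the block over `e` further cells. -/
theorem exists_abs_sub_meshInterp_le (d r e : ℕ) :
    ∃ C : ℝ, 0 ≤ C ∧ ∀ f : EuclideanSpace ℝ (Fin d) → ℝ, ContinuousOn f (unitCube d) →
      ∀ (m : ℕ) (a k : Fin d → ℤ), (∀ i, 0 ≤ a i ∧ a i + r ≤ 2 ^ m) →
        (∀ i, 0 ≤ k i ∧ k i ≤ 2 ^ m) → (∀ i, a i - e ≤ k i ∧ k i < a i + r + e) →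
        |f (meshPoint m k) - meshInterp r f m a (meshPoint m k)|
          ≤ C * (discreteModulus r f m).toReal := by
  refine ⟨((2 ^ r) ^ e) ^ d, by positivity, fun f hf m a k ha hk hka => ?_⟩
  refine abs_le_of_coordinate_differences
    (g := fun k => f (meshPoint m k) - meshInterp r f m a (meshPoint m k))
    (fun i => (ha i).1) (fun i => (ha i).2) ENNReal.toReal_nonneg (fun i k hk hki => ?_)
    (fun k hk => ?_) e k hk hka
  · have h1 := abs_rDiff_le_discreteModulus (r := r) hf i k hk hki
    rw [← sub_zero (rDiff _ _ _ _), ← rDiff_axis_eq_zero (meshInterp_mem r f m a)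
      ((2 : ℝ) ^ (-(m : ℤ))) i (meshPoint m k), ← rDiff_sub] at h1
    simpa only [rDiff, meshPoint_add_smul_axis, Pi.sub_apply] using h1
  · rw [meshInterp_of_lt f m hk, sub_self, abs_zero]
    exact ENNReal.toReal_nonneg

/-- Interpolants of the same level are close at each other's nodes. -/
theorem exists_abs_meshInterp_sub_node_le (d r K : ℕ) :
    ∃ C : ℝ, 0 ≤ C ∧ ∀ f : EuclideanSpace ℝ (Fin d) → ℝ, ContinuousOn f (unitCube d) →
      ∀ (m : ℕ) (a a' : Fin d → ℤ), (∀ i, 0 ≤ a i ∧ a i + r ≤ 2 ^ m) →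
        (∀ i, 0 ≤ a' i ∧ a' i + r ≤ 2 ^ m) → (∀ i, |a i - a' i| ≤ K) → ∀ j : Fin d → Fin r,
        |(meshInterp r f m a - meshInterp r f m a') (meshPoint m fun i => a i + (j i : ℕ))|
          ≤ C * (discreteModulus r f m).toReal := by
  obtain ⟨C, hC0, hC⟩ := exists_abs_sub_meshInterp_le d r K
  refine ⟨C, hC0, fun f hf m a a' ha ha' haa j => ?_⟩
  rw [Pi.sub_apply, meshInterp_node]
  refine hC f hf m a' _ ha' (fun i => ?_) fun i => ?_
  all_goals
    have := ha i
    have := (j i).2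
    have := abs_le.1 (haa i)
    omega

/-- Interpolants of successive levels are close at the nodes of the coarser one. -/
theorem exists_abs_meshInterp_succ_sub_node_le (d r K : ℕ) :
    ∃ C : ℝ, 0 ≤ C ∧ ∀ f : EuclideanSpace ℝ (Fin d) → ℝ, ContinuousOn f (unitCube d) →
      ∀ (m : ℕ) (a a' : Fin d → ℤ), (∀ i, 0 ≤ a i ∧ a i + r ≤ 2 ^ m) →
        (∀ i, 0 ≤ a' i ∧ a' i + r ≤ 2 ^ (m + 1)) → (∀ i, |2 * a i - a' i| ≤ K) →
        ∀ j : Fin d → Fin r,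
        |(meshInterp r f m a - meshInterp r f (m + 1) a') (meshPoint m fun i => a i + (j i : ℕ))|
          ≤ C * (discreteModulus r f (m + 1 : ℕ)).toReal := by
  -- A coarse node is a fine mesh point with index `2 * (a i + j i)`; as `j i < r`, it lies at most
  -- `K + r` places outside the fine block.
  obtain ⟨C, hC0, hC⟩ := exists_abs_sub_meshInterp_le d r (K + r)
  refine ⟨C, hC0, fun f hf m a a' ha ha' haa j => ?_⟩
  have hpt : meshPoint (m : ℤ) (fun i => a i + (j i : ℕ))
      = meshPoint (m + 1 : ℕ) fun i => 2 * (a i + (j i : ℕ)) := by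
    ext i
    simp only [meshPoint, zpow_neg, zpow_natCast, pow_succ]
    push_cast
    field_simp
  rw [Pi.sub_apply, meshInterp_node, hpt]
  refine hC f hf (m + 1) a' _ ha' (fun i => ?_) fun i => ?_
  all_goals
    have := ha i
    have := (j i).2
    have := abs_le.1 (haa i)
    have := pow_succ (2 : ℤ) m
    push_cast
    omega

/-- The mesh cell `a` of level `m` is a base for interpolation near `x`. -/
def IsBase {d : ℕ} (r m : ℕ) (x : EuclideanSpace ℝ (Fin d)) (a : Fin d → ℤ) : Prop :=
  ∀ i, (0 ≤ a i ∧ a i + r ≤ 2 ^ m) ∧ (a i : ℝ) ≤ 2 ^ m * x i ∧ 2 ^ m * x i ≤ a i + r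

/-- The floor is capped at `2 ^ m - r` so that the block fits in the cube. Near the upper faces this
pushes the block back, whence the slack of `r` cells in `IsBase`. -/
theorem exists_isBase {d r m : ℕ} (hr : 1 ≤ r) (hm : r ≤ 2 ^ m) {x : EuclideanSpace ℝ (Fin d)}
    (hx : x ∈ unitCube d) : ∃ a, IsBase r m x a := by
  have hm' : (r : ℤ) ≤ 2 ^ m := by exact_mod_cast hm
  have hr' : (1 : ℝ) ≤ r := by exact_mod_cast hr
  refine ⟨fun i => min ⌊2 ^ m * x i⌋ (2 ^ m - r), fun i => ?_⟩
  have h0 : (0 : ℤ) ≤ ⌊2 ^ m * x i⌋ := Int.floor_nonneg.2 (mul_nonneg (by positivity) (hx i).1)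
  have h1 : 2 ^ m * x i ≤ 2 ^ m := mul_le_of_le_one_right (by positivity) (hx i).2
  refine ⟨⟨by simp [h0, hm'], by linarith [min_le_right ⌊2 ^ m * x i⌋ ((2 : ℤ) ^ m - r)]⟩, ?_, ?_⟩
  · exact (Int.cast_le.2 (min_le_left _ _)).trans (Int.floor_le _)
  · beta_reduce
    rcases min_cases ⌊2 ^ m * x i⌋ ((2 : ℤ) ^ m - r) with ⟨h, _⟩ | ⟨h, _⟩
    · rw [h]
      linarith [Int.lt_floor_add_one (2 ^ m * x i)]
    · rw [h]
      push_cast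
      linarith

theorem IsBase.abs_two_mul_sub_le {d r m : ℕ} {x : EuclideanSpace ℝ (Fin d)} {a a' : Fin d → ℤ}
    (ha : IsBase r m x a) (ha' : IsBase r (m + 1) x a') (i : Fin d) :
    |2 * a i - a' i| ≤ (2 * r : ℕ) := by
  obtain ⟨_, h1, h2⟩ := ha i
  obtain ⟨_, h3, h4⟩ := ha' i
  rw [pow_succ] at h3 h4
  have : |2 * (a i : ℝ) - a' i| ≤ 2 * r := by
    have hr : (0 : ℝ) ≤ r := Nat.cast_nonneg r
    rw [abs_le]; constructor <;> linarith
  exact_mod_cast this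

theorem IsBase.abs_sub_le {d r m : ℕ} {x : EuclideanSpace ℝ (Fin d)} {a : Fin d → ℤ}
    (ha : IsBase r m x a) (i : Fin d) : |x i - 2 ^ (-(m : ℤ)) * a i| ≤ r * 2 ^ (-(m : ℤ)) := by
  obtain ⟨_, h1, h2⟩ := ha i
  have hp : (0 : ℝ) < 2 ^ m := by positivity
  have hx : x i = (2 ^ m)⁻¹ * (2 ^ m * x i) := by field_simp
  rw [zpow_neg, zpow_natCast, hx, ← mul_sub, abs_mul, abs_of_pos (inv_pos.2 hp), mul_comm]
  refine mul_le_mul_of_nonneg_right ?_ (by positivity)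
  rw [abs_le]; constructor <;> linarith [(Nat.cast_nonneg r : (0 : ℝ) ≤ r)]

/-- Telescoping through the levels: passing from `a` to `A 0` costs the modulus of level `n`, and
each refinement costs that of the new level. The point `z` may differ from `y` so that it can later
be a node of the finest interpolant. -/
theorem exists_abs_meshInterp_sub_le (d r : ℕ) :
    ∃ C : ℝ, 0 ≤ C ∧ ∀ f : EuclideanSpace ℝ (Fin d) → ℝ, ContinuousOn f (unitCube d) →
      ∀ (n : ℕ) (a : Fin d → ℤ), (∀ i, 0 ≤ a i ∧ a i + r ≤ 2 ^ n) →
      ∀ (y : EuclideanSpace ℝ (Fin d)), (∀ i, |y i - 2 ^ (-(n : ℤ)) * a i| ≤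
        (2 * r : ℕ) * 2 ^ (-(n : ℤ))) →
      ∀ A : ℕ → Fin d → ℤ, (∀ l, IsBase r (n + l) y (A l)) →
      ∀ (l : ℕ) (z : EuclideanSpace ℝ (Fin d)),
        (∀ i, |z i - y i| ≤ r * 2 ^ (-((n + l : ℕ) : ℤ))) →
        |meshInterp r f n a z - meshInterp r f (n + l) (A l) z|
          ≤ C * ∑ k ∈ Finset.range (l + 1), (discreteModulus r f (n + k : ℕ)).toReal := by
  obtain ⟨C₁, hC₁0, hC₁⟩ := exists_abs_meshInterp_sub_node_le d r (3 * r)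
  obtain ⟨C₂, hC₂0, hC₂⟩ := exists_abs_meshInterp_succ_sub_node_le d r (2 * r)
  obtain ⟨C₃, hC₃0, hC₃⟩ := exists_abs_le_of_mesh (d := d) (r := r) (3 * r)
  refine ⟨C₃ * (C₁ + C₂), by positivity, fun f hf n a ha y hy A hA l => ?_⟩
  have hr : (0 : ℝ) ≤ r := Nat.cast_nonneg r
  induction l with
  | zero =>
    intro z hz
    have h1 : ∀ i, |a i - A 0 i| ≤ (3 * r : ℕ) := by
      intro i
      have h2 := hy i
      have h3 := (hA 0).abs_sub_le i
      rw [add_zero] at h3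
      have hp : (0 : ℝ) < 2 ^ (-(n : ℤ)) := by positivity
      have h4 : |(a i : ℝ) - A 0 i| * 2 ^ (-(n : ℤ)) ≤ (3 * r) * 2 ^ (-(n : ℤ)) := by
        rw [← abs_of_pos hp, ← abs_mul, abs_of_pos hp]
        push_cast at h2
        rw [abs_le] at *
        constructor <;> linarith
      exact_mod_cast le_of_mul_le_mul_right h4 hp
    have h2 := hC₃ _ (Submodule.sub_mem _ (meshInterp_mem r f n a) (meshInterp_mem r f n (A 0)))
      _ n a (hC₁ f hf n a (A 0) ha (fun i => (hA 0 i).1) h1) z fun i => ?_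
    · simp only [zero_add, Finset.sum_range_one, add_zero]
      refine h2.trans ?_
      rw [mul_assoc]
      exact mul_le_mul_of_nonneg_left (mul_le_mul_of_nonneg_right (by linarith)
        ENNReal.toReal_nonneg) hC₃0
    · have h3 := hy i
      have h4 := hz i
      rw [add_zero] at h4
      push_cast at h3
      refine (abs_sub_le _ (y i) _).trans ?_
      linarith
  | succ l ih =>
    intro z hz
    have hpow : (2 : ℝ) ^ (-((n + l : ℕ) : ℤ)) = 2 * 2 ^ (-((n + (l + 1) : ℕ) : ℤ)) := by
      rw [zpow_neg, zpow_neg, zpow_natCast, zpow_natCast, ← add_assoc, pow_succ]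
      field_simp
    have hp : (0 : ℝ) < 2 ^ (-((n + (l + 1) : ℕ) : ℤ)) := by positivity
    have hz' : ∀ i, |z i - y i| ≤ r * 2 ^ (-((n + l : ℕ) : ℤ)) := by
      intro i
      refine (hz i).trans ?_
      rw [hpow]
      exact mul_le_mul_of_nonneg_left (by linarith) hr
    have h1 := ih z hz'
    have h2 := hC₃ _ (Submodule.sub_mem _ (meshInterp_mem r f (n + l) (A l))
      (meshInterp_mem r f (n + l + 1) (A (l + 1))))
      _ (n + l : ℕ) (A l) (hC₂ f hf (n + l) (A l) (A (l + 1)) (fun i => (hA l i).1)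
        (fun i => (hA (l + 1) i).1) (fun i => (hA l).abs_two_mul_sub_le (hA (l + 1)) i)) z
      fun i => ?_
    · rw [Finset.sum_range_succ, mul_add]
      refine (abs_sub_le _ (meshInterp r f (n + l) (A l) z) _).trans (add_le_add h1 ?_)
      refine h2.trans ?_
      rw [mul_assoc]
      exact mul_le_mul_of_nonneg_left (mul_le_mul_of_nonneg_right (by linarith)
        ENNReal.toReal_nonneg) hC₃0
    · have h3 := (hA l).abs_sub_le i
      have h4 := hz' i
      have : 0 ≤ r * (2 : ℝ) ^ (-((n + l : ℕ) : ℤ)) := by positivity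
      refine (abs_sub_le _ (y i) _).trans ?_
      linarith

/-- Near its nodes the local interpolant of level `n` approximates `f` up to the sum of the
discrete moduli of the levels `≥ n`. -/
theorem exists_enorm_sub_meshInterp_le (d r : ℕ) (hr : 1 ≤ r) :
    ∃ C : ℝ≥0, ∀ f : EuclideanSpace ℝ (Fin d) → ℝ, ContinuousOn f (unitCube d) →
      ∀ n : ℕ, r ≤ 2 ^ n → ∀ a : Fin d → ℤ, (∀ i, 0 ≤ a i ∧ a i + r ≤ 2 ^ n) →
      ∀ y ∈ unitCube d, (∀ i, |y i - 2 ^ (-(n : ℤ)) * a i| ≤ (2 * r : ℕ) * 2 ^ (-(n : ℤ))) →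
        ‖f y - meshInterp r f n a y‖ₑ
          ≤ (C : ℝ≥0∞) * ∑' k : ℕ, discreteModulus r f ((n : ℤ) + k) := by
  obtain ⟨C, hC0, hC⟩ := exists_abs_meshInterp_sub_le d r
  refine ⟨C.toNNReal, fun f hf n hn a ha y hy hya => ?_⟩
  choose A hA using fun l : ℕ => exists_isBase (m := n + l) hr
    (hn.trans (Nat.pow_le_pow_right (by norm_num) (Nat.le_add_right n l))) hy
  have hcube : ∀ l, meshPoint ((n + l : ℕ) : ℤ) (A l) ∈ unitCube d := fun l =>
    meshPoint_mem_unitCube fun i => ⟨(hA l i).1.1, by have := (hA l i).1.2; omega⟩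
  have hdist : ∀ l i, |meshPoint ((n + l : ℕ) : ℤ) (A l) i - y i|
      ≤ r * 2 ^ (-((n + l : ℕ) : ℤ)) := fun l i => by
    rw [abs_sub_comm]; exact (hA l).abs_sub_le i
  have hlim : Filter.Tendsto (fun l : ℕ => meshPoint ((n + l : ℕ) : ℤ) (A l)) Filter.atTop
      (nhds y) := by
    refine ((PiLp.continuous_toLp 2 _).tendsto y.ofLp).comp (tendsto_pi_nhds.2 fun i => ?_)
    refine tendsto_iff_dist_tendsto_zero.2 (squeeze_zero (fun _ => dist_nonneg)
      (fun l => hdist l i) ?_)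
    have hgeom := (tendsto_pow_atTop_nhds_zero_of_lt_one (r := (2 : ℝ)⁻¹) (by norm_num)
      (by norm_num)).const_mul (r * ((2 : ℝ) ^ n)⁻¹)
    rw [mul_zero] at hgeom
    refine hgeom.congr fun l => ?_
    rw [zpow_neg, zpow_natCast, pow_add, mul_inv, inv_pow, mul_assoc]
  have hlim' : Filter.Tendsto (fun l : ℕ => meshPoint ((n + l : ℕ) : ℤ) (A l)) Filter.atTop
      (nhdsWithin y (unitCube d)) :=
    tendsto_nhdsWithin_iff.2 ⟨hlim, Filter.Eventually.of_forall hcube⟩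
  have hlim2 := (((hf y hy).tendsto.comp hlim').sub
    (((continuous_of_mem_coordPoly (meshInterp_mem r f n a)).tendsto y).comp hlim)).enorm
  -- Each approximating mesh point is a node of its own interpolant, where `f` and that interpolant
  -- agree; the telescoped bound then passes to the limit by continuity.
  refine le_of_tendsto hlim2 (Filter.Eventually.of_forall fun l => ?_)
  have h1 := hC f hf n a ha y hya A hA l _ (hdist l)
  rw [meshInterp_of_lt (a := A l) f (n + l) fun i => ⟨le_rfl, by omega⟩, abs_sub_comm] at h1
  simp only [Function.comp_apply]
  rw [Real.enorm_eq_ofReal_abs]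
  refine (ENNReal.ofReal_le_ofReal h1).trans ?_
  rw [ENNReal.ofReal_mul hC0, ENNReal.ofReal_sum_of_nonneg fun _ _ => ENNReal.toReal_nonneg]
  refine mul_le_mul_right ?_ _
  refine le_trans (Finset.sum_le_sum fun k _ => ?_) (ENNReal.sum_le_tsum (Finset.range (l + 1)))
  rw [ENNReal.ofReal_toReal (discreteModulus_ne_top hf _)]
  push_cast
  rfl

/-! ### Differences of the local interpolants -/

/-- One jump between consecutive levels; with η a negative power of 2 it supplies the geometric
weights. -/
theorem exists_abs_rDiff_meshInterp_sub_le (d r : ℕ) :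
    ∃ C : ℝ, 0 ≤ C ∧ ∀ f : EuclideanSpace ℝ (Fin d) → ℝ, ContinuousOn f (unitCube d) →
      ∀ (m : ℕ) (x h : EuclideanSpace ℝ (Fin d)) (a a' : Fin d → ℤ), IsBase r m x a →
        IsBase r (m + 1) x a' → ∀ η : ℝ, 0 < η → η ≤ 1 → (∀ i, |h i| ≤ η * 2 ^ (-(m : ℤ))) →
        |rDiff r h (meshInterp r f m a - meshInterp r f (m + 1) a') x|
          ≤ C * η ^ r * (discreteModulus r f (m + 1 : ℕ)).toReal := by
  obtain ⟨C₁, hC₁0, hC₁⟩ := exists_abs_meshInterp_succ_sub_node_le d r (2 * r)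
  obtain ⟨C₂, hC₂0, hC₂⟩ := exists_abs_rDiff_le_of_mesh (d := d) (r := r) r
  refine ⟨C₂ * C₁, by positivity, fun f hf m x h a a' ha ha' η h0 h1 hh => ?_⟩
  refine (hC₂ _ (Submodule.sub_mem _ (meshInterp_mem r f m a) (meshInterp_mem r f (m + 1) a')) _ m
    a (hC₁ f hf m a a' (fun i => (ha i).1) (fun i => (ha' i).1) (ha.abs_two_mul_sub_le ha'))
    x h η h0 h1 ha.abs_sub_le hh).trans_eq (by ring)

/-- Node values of the interpolant are values of `f`; applied at the coarsest level, this supplies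
the term t^r‖f‖. -/
theorem exists_abs_rDiff_meshInterp_le (d r : ℕ) :
    ∃ C : ℝ, 0 ≤ C ∧ ∀ f : EuclideanSpace ℝ (Fin d) → ℝ, ContinuousOn f (unitCube d) →
      ∀ (m : ℕ) (x h : EuclideanSpace ℝ (Fin d)) (a : Fin d → ℤ), IsBase r m x a →
        ∀ η : ℝ, 0 < η → η ≤ 1 → (∀ i, |h i| ≤ η * 2 ^ (-(m : ℤ))) →
        |rDiff r h (meshInterp r f m a) x| ≤ C * η ^ r * (cubeNorm f).toReal := by
  obtain ⟨C, hC0, hC⟩ := exists_abs_rDiff_le_of_mesh (d := d) (r := r) r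
  refine ⟨C, hC0, fun f hf m x h a ha η h0 h1 hh => ?_⟩
  refine hC _ (meshInterp_mem r f m a) _ m a (fun j => ?_) x h η h0 h1 ha.abs_sub_le hh
  rw [meshInterp_node]
  refine abs_le_cubeNorm hf (meshPoint_mem_unitCube fun i => ?_)
  have := (ha i).1
  have := (j i).2
  omega

theorem enorm_rDiff_le {d : ℕ} (r : ℕ) (h : EuclideanSpace ℝ (Fin d))
    (g : EuclideanSpace ℝ (Fin d) → ℝ) (x : EuclideanSpace ℝ (Fin d)) (B : ℝ≥0∞)
    (hB : ∀ k ≤ r, ‖g (x + (k : ℝ) • h)‖ₑ ≤ B) : ‖rDiff r h g x‖ₑ ≤ 2 ^ r * B := by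
  rcases eq_or_ne B ⊤ with rfl | hB'
  · simp
  have h1 := abs_rDiff_le r h g x B.toReal fun k hk => by
    rw [← ENNReal.ofReal_le_iff_le_toReal hB', ← Real.enorm_eq_ofReal_abs]; exact hB k hk
  rw [Real.enorm_eq_ofReal_abs]
  refine (ENNReal.ofReal_le_ofReal h1).trans_eq ?_
  rw [ENNReal.ofReal_mul (by positivity), ENNReal.ofReal_toReal hB',
    ENNReal.ofReal_pow (by norm_num)]
  norm_num

/-- The difference of `f` minus its local interpolant, on a fine mesh or on a mesh so coarse that
the whole cube is close to the nodes. -/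
theorem exists_enorm_rDiff_sub_meshInterp_le (d r : ℕ) (hr : 1 ≤ r) :
    ∃ C : ℝ≥0, ∀ f : EuclideanSpace ℝ (Fin d) → ℝ, ContinuousOn f (unitCube d) →
      ∀ n : ℕ, r ≤ 2 ^ n → ∀ (x h : EuclideanSpace ℝ (Fin d)) (a : Fin d → ℤ), x ∈ unitCube d →
        x + (r : ℝ) • h ∈ unitCube d → IsBase r n x a →
        ((∀ i, |h i| ≤ 2 ^ (-(n : ℤ))) ∨ 2 ^ n ≤ 2 * r) →
        ‖rDiff r h (f - meshInterp r f n a) x‖ₑ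
          ≤ (C : ℝ≥0∞) * ∑' k : ℕ, discreteModulus r f ((n : ℤ) + k) := by
  obtain ⟨C, hC⟩ := exists_enorm_sub_meshInterp_le d r hr
  refine ⟨2 ^ r * C, fun f hf n hn x h a hx hxh ha hh => ?_⟩
  push_cast
  rw [mul_assoc]
  refine enorm_rDiff_le r h _ x _ fun k hk => ?_
  have hy := add_smul_mem_unitCube hx hxh hk
  refine hC f hf n hn a (fun i => (ha i).1) _ hy fun i => ?_
  have hp : (0 : ℝ) < 2 ^ (-(n : ℤ)) := by positivity
  -- For small steps, `x` is within `r` cells of the base and `k • h` adds at most `r` more. On a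
  -- coarse mesh the whole cube spans at most `2 * r` cells.
  rcases hh with hh | hh
  · have h1 : |(k : ℝ) * h i| ≤ r * 2 ^ (-(n : ℤ)) := by
      rw [abs_mul, Nat.abs_cast]
      exact mul_le_mul (by exact_mod_cast hk) (hh i) (abs_nonneg _) (Nat.cast_nonneg r)
    have h2 := ha.abs_sub_le i
    simp only [PiLp.add_apply, PiLp.smul_apply, smul_eq_mul]
    push_cast
    rw [abs_le] at *
    constructor <;> linarith
  · have h1 : (1 : ℝ) ≤ (2 * r : ℕ) * 2 ^ (-(n : ℤ)) := by
      rw [zpow_neg, zpow_natCast, ← div_eq_mul_inv, one_le_div (by positivity)]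
      exact_mod_cast hh
    have h2 := meshPoint_mem_unitCube (m := n) (k := a)
      (fun i => ⟨(ha i).1.1, by have := (ha i).1.2; omega⟩) i
    have h3 := hy i
    refine le_trans ?_ h1
    simp only [meshPoint, Set.mem_Icc] at h2 h3
    rw [abs_le]
    constructor <;> linarith [h2.1, h2.2, h3.1, h3.2]

/-! ### Choice of level and assembly of the three estimates -/

theorem exists_level {r : ℕ} (hr : 1 ≤ r) (n : ℤ) :
    ∃ N : ℕ, r ≤ 2 ^ N ∧ n ≤ N ∧ ((N : ℤ) = n ∨ 2 ^ N ≤ 2 * r) := by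
  have h1 : r ≤ 2 ^ Nat.clog 2 r := Nat.le_pow_clog (by norm_num) r
  have h2 : 2 ^ Nat.clog 2 r ≤ 2 * r := by
    rcases hr.eq_or_lt with rfl | hr
    · simp
    · have h3 := Nat.pow_pred_clog_lt_self (b := 2) (by norm_num) hr
      have h4 : 0 < Nat.clog 2 r := Nat.clog_pos (by norm_num) hr
      obtain ⟨c, hc⟩ := Nat.exists_eq_succ_of_ne_zero h4.ne'
      rw [hc] at h3 ⊢
      rw [pow_succ]
      simp at h3
      omega
  -- If 2^n < r no block of `r` nodes fits, so the coarsest admissible level is used instead; this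
  -- includes negative `n`.
  rcases le_total n (Nat.clog 2 r) with h | h
  · exact ⟨_, h1, h, Or.inr h2⟩
  · obtain ⟨l, hl⟩ := Int.eq_ofNat_of_zero_le (a := n) (by omega)
    refine ⟨l, h1.trans (Nat.pow_le_pow_right (by norm_num) (by omega)), by omega, by omega⟩

theorem tsum_discreteModulus_anti {d r : ℕ} (f : EuclideanSpace ℝ (Fin d) → ℝ) {n N : ℤ}
    (h : n ≤ N) :
    ∑' k : ℕ, discreteModulus r f (N + k) ≤ ∑' k : ℕ, discreteModulus r f (n + k) := by
  obtain ⟨l, hl⟩ := Int.le.dest h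
  have := ENNReal.tsum_comp_le_tsum_of_injective (add_right_injective l)
    fun k : ℕ => discreteModulus r f (n + k)
  refine le_trans (le_of_eq (tsum_congr fun k => ?_)) this
  rw [← hl]
  push_cast
  rw [add_assoc]

/-- Up to the sum of the discrete moduli of the levels `≥ n`, the differences of `f` with steps
at most `2^{-n}` are those of a polynomial. -/
theorem exists_enorm_rDiff_sub_coordPoly_le (d r : ℕ) (hr : 1 ≤ r) :
    ∃ C : ℝ≥0, ∀ f : EuclideanSpace ℝ (Fin d) → ℝ, ContinuousOn f (unitCube d) →
      ∀ (n : ℤ) (x h : EuclideanSpace ℝ (Fin d)), x ∈ unitCube d →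
        x + (r : ℝ) • h ∈ unitCube d → (∀ i, |h i| ≤ 2 ^ (-n)) →
        ∃ q ∈ coordPoly d r, ‖rDiff r h f x - rDiff r h q x‖ₑ
          ≤ (C : ℝ≥0∞) * ∑' k : ℕ, discreteModulus r f (n + k) := by
  obtain ⟨C, hC⟩ := exists_enorm_rDiff_sub_meshInterp_le d r hr
  refine ⟨C, fun f hf n x h hx hxh hh => ?_⟩
  obtain ⟨N, hN, hnN, hN'⟩ := exists_level hr n
  obtain ⟨a, ha⟩ := exists_isBase hr hN hx
  refine ⟨_, meshInterp_mem r f N a, ?_⟩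
  rw [← rDiff_sub]
  refine (hC f hf N hN x h a hx hxh ha (hN'.imp_left fun h => by rwa [h])).trans ?_
  exact mul_le_mul_right (tsum_discreteModulus_anti f hnN) _

theorem exists_enorm_rDiff_axis_le (d r : ℕ) (hr : 1 ≤ r) :
    ∃ M : ℝ≥0, ∀ f : EuclideanSpace ℝ (Fin d) → ℝ, ContinuousOn f (unitCube d) →
      ∀ (n : ℤ) (t : ℝ), 0 ≤ t → t ≤ (2 : ℝ) ^ (-n) →
      ∀ (i : Fin d) (u : EuclideanSpace ℝ (Fin d)),
        u ∈ unitCube d → u + ((r : ℝ) * t) • axis i ∈ unitCube d →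
        ‖rDiff r (t • axis i) f u‖ₑ
          ≤ (M : ℝ≥0∞) * ∑' k : ℕ, discreteModulus r f (n + (k : ℤ)) := by
  obtain ⟨C, hC⟩ := exists_enorm_rDiff_sub_coordPoly_le d r hr
  refine ⟨C, fun f hf n t h0 ht i u hu hui => ?_⟩
  have hstep : ∀ l, |(t • axis i : EuclideanSpace ℝ (Fin d)) l| ≤ 2 ^ (-n) := by
    intro l
    refine le_trans ?_ ht
    rcases eq_or_ne l i with rfl | hl
    · simp [axis, abs_of_nonneg h0]
    · simpa [axis, hl] using h0
  obtain ⟨q, hq, h⟩ := hC f hf n u (t • axis i) hu (by rwa [smul_smul]) hstep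
  rwa [rDiff_axis_eq_zero hq, sub_zero] at h

theorem exists_modulus_one_le (d : ℕ) :
    ∃ M : ℝ≥0, ∀ f : EuclideanSpace ℝ (Fin d) → ℝ, ContinuousOn f (unitCube d) →
      ∀ (n : ℤ) (t : ℝ), 0 ≤ t → t ≤ (2 : ℝ) ^ (-n) →
        modulus 1 f t ≤ (M : ℝ≥0∞) * ∑' k : ℕ, discreteModulus 1 f (n + (k : ℤ)) := by
  obtain ⟨C, hC⟩ := exists_enorm_rDiff_sub_coordPoly_le d 1 le_rfl
  refine ⟨C, fun f hf n t _ ht => iSup₂_le fun h hh => iSup₂_le fun x hx => iSup_le fun hxh => ?_⟩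
  obtain ⟨q, hq, hle⟩ := hC f hf n x h hx hxh fun i =>
    (PiLp.norm_apply_le h i).trans (hh.trans ht)
  have : rDiff 1 h q x = 0 := by
    simp [rDiff, Finset.sum_range_succ, coordPoly_one_const hq (x + h) x]
  rwa [this, sub_zero] at hle

theorem ofReal_two_zpow_neg_pow (s r : ℕ) :
    ENNReal.ofReal (((2 : ℝ) ^ (-(s : ℤ))) ^ r) = (2 : ℝ≥0∞) ^ (-((s : ℤ) * (r : ℤ))) := by
  rw [← Nat.cast_mul, zpow_neg, zpow_natCast, inv_pow, ← pow_mul, ENNReal.zpow_neg,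
    zpow_natCast, ENNReal.ofReal_inv_of_pos (by positivity), ENNReal.ofReal_pow (by norm_num)]
  norm_num

theorem exists_enorm_rDiff_le (d r : ℕ) (hr : 1 ≤ r) :
    ∃ C : ℝ≥0, ∀ f : EuclideanSpace ℝ (Fin d) → ℝ, ContinuousOn f (unitCube d) →
      ∀ m L : ℕ, r ≤ 2 ^ m → 2 ^ m ≤ 2 * r → ∀ t : ℝ, 0 < t → t ≤ 2 ^ (-((m + L : ℕ) : ℤ)) →
      ∀ x h : EuclideanSpace ℝ (Fin d), x ∈ unitCube d → x + (r : ℝ) • h ∈ unitCube d → ‖h‖ ≤ t →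
        ‖rDiff r h f x‖ₑ ≤ (C : ℝ≥0∞) *
          ((∑' k : ℕ, discreteModulus r f ((m + L : ℕ) + (k : ℤ))) +
            (∑ s ∈ Finset.range L, (2 : ℝ≥0∞) ^ (-((s : ℤ) * (r : ℤ))) *
              discreteModulus r f ((m + L : ℕ) - (s : ℤ))) +
            ENNReal.ofReal (t ^ r) * cubeNorm f) := by
  obtain ⟨C₁, hC₁⟩ := exists_enorm_rDiff_sub_meshInterp_le d r hr
  obtain ⟨C₂, hC₂0, hC₂⟩ := exists_abs_rDiff_meshInterp_sub_le d r
  obtain ⟨C₃, hC₃0, hC₃⟩ := exists_abs_rDiff_meshInterp_le d r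
  refine ⟨C₁ + C₂.toNNReal + (C₃ * (2 * r) ^ r).toNNReal,
    fun f hf m L hm hm2 t ht0 ht x h hx hxh hht => ?_⟩
  choose A hA using fun k : ℕ => exists_isBase (m := m + k) hr
    (hm.trans (Nat.pow_le_pow_right (by norm_num) (Nat.le_add_right m k))) hx
  have hhi : ∀ i, |h i| ≤ t := fun i => (PiLp.norm_apply_le h i).trans hht
  -- The index is reversed so that `s` counts levels down from the finest one.
  have htel : rDiff r h f x = rDiff r h (f - meshInterp r f (m + L) (A L)) x +
      (-∑ s ∈ Finset.range L, rDiff r h (meshInterp r f (m + (L - 1 - s)) (A (L - 1 - s)) -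
        meshInterp r f (m + (L - 1 - s) + 1) (A (L - 1 - s + 1))) x) +
      rDiff r h (meshInterp r f m (A 0)) x := by
    rw [Finset.sum_range_reflect (fun k => rDiff r h (meshInterp r f (m + k) (A k) -
        meshInterp r f (m + k + 1) (A (k + 1))) x) L]
    simp only [rDiff_sub]
    have := Finset.sum_range_sub' (fun k => rDiff r h (meshInterp r f (m + k) (A k)) x) L
    simp only [← add_assoc, add_zero] at this
    rw [this]
    ring
  have h1 := hC₁ f hf (m + L) (hm.trans (Nat.pow_le_pow_right (by norm_num) (by omega))) x h (A L)
    hx hxh (hA L) (Or.inl fun i => (hhi i).trans ht)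
  have h2 : ‖-∑ s ∈ Finset.range L, rDiff r h (meshInterp r f (m + (L - 1 - s)) (A (L - 1 - s)) -
        meshInterp r f (m + (L - 1 - s) + 1) (A (L - 1 - s + 1))) x‖ₑ ≤ (C₂.toNNReal : ℝ≥0∞) *
        ∑ s ∈ Finset.range L, (2 : ℝ≥0∞) ^ (-((s : ℤ) * (r : ℤ))) *
              discreteModulus r f ((m + L : ℕ) - (s : ℤ)) := by
    rw [enorm_neg, Finset.mul_sum]
    refine (enorm_sum_le _ _).trans (Finset.sum_le_sum fun s hs => ?_)
    have hs := Finset.mem_range.1 hs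
    -- At level `m + L - 1 - s` the choice η = 2^{-s} allows steps up to 2 · 2^{-(m+L)}, which
    -- covers `t`.
    have h3 := hC₂ f hf (m + (L - 1 - s)) x h (A (L - 1 - s)) (A (L - 1 - s + 1)) (hA _) (hA _)
      ((2 : ℝ) ^ (-(s : ℤ))) (by positivity)
      (zpow_le_one_of_nonpos₀ (by norm_num) (by omega)) fun i => ?_
    · rw [Real.enorm_eq_ofReal_abs]
      refine (ENNReal.ofReal_le_ofReal h3).trans_eq ?_
      rw [ENNReal.ofReal_mul (by positivity), ENNReal.ofReal_mul hC₂0,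
        ENNReal.ofReal_toReal (discreteModulus_ne_top hf _), ofReal_two_zpow_neg_pow, mul_assoc]
      have : ((m + (L - 1 - s) + 1 : ℕ) : ℤ) = (m + L : ℕ) - (s : ℤ) := by omega
      rw [this]
      rfl
    · refine ((hhi i).trans ht).trans ?_
      rw [← zpow_add₀ (by norm_num)]
      exact zpow_le_zpow_right₀ (by norm_num) (by omega)
  have h4 : ‖rDiff r h (meshInterp r f m (A 0)) x‖ₑ ≤ ((C₃ * (2 * r) ^ r).toNNReal : ℝ≥0∞) *
      (ENNReal.ofReal (t ^ r) * cubeNorm f) := by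
    have hpm : (0 : ℝ) < 2 ^ m := by positivity
    -- Here η = t 2^m is at most 1, and 2^m ≤ 2r bounds η^r by (2r)^r t^r.
    have h5 := hC₃ f hf m x h (A 0) (hA 0) (t * 2 ^ m) (by positivity) ?_ fun i => ?_
    · rw [Real.enorm_eq_ofReal_abs]
      have h6 : C₃ * (t * 2 ^ m) ^ r * (cubeNorm f).toReal
          ≤ C₃ * (2 * r) ^ r * (t ^ r * (cubeNorm f).toReal) := by
        rw [mul_pow]
        have : ((2 : ℝ) ^ m) ^ r ≤ (2 * r) ^ r :=
          pow_le_pow_left₀ (by positivity) (by exact_mod_cast hm2) _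
        calc _ = C₃ * (t ^ r * (cubeNorm f).toReal) * ((2 : ℝ) ^ m) ^ r := by ring
          _ ≤ C₃ * (t ^ r * (cubeNorm f).toReal) * (2 * r) ^ r :=
            mul_le_mul_of_nonneg_left this (by positivity)
          _ = _ := by ring
      refine (ENNReal.ofReal_le_ofReal (h5.trans h6)).trans_eq ?_
      rw [ENNReal.ofReal_mul (p := C₃ * (2 * r) ^ r) (by positivity),
        ENNReal.ofReal_mul (p := t ^ r) (by positivity), ENNReal.ofReal_toReal (cubeNorm_ne_top hf)]
      rfl
    · have h7 : t ≤ 2 ^ (-(m : ℤ)) :=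
        ht.trans (zpow_le_zpow_right₀ (by norm_num) (by omega))
      rw [zpow_neg, zpow_natCast] at h7
      exact (le_inv_mul_iff₀ hpm).1 (by simpa using h7) |>.trans_eq' (mul_comm _ _)
    · rw [zpow_neg, zpow_natCast, mul_assoc, mul_inv_cancel₀ hpm.ne', mul_one]
      exact hhi i
  rw [htel]
  refine (enorm_add_le _ _).trans ((add_le_add ((enorm_add_le _ _).trans (add_le_add h1 h2))
    h4).trans ?_)
  push_cast
  simp only [mul_add, add_mul]
  gcongr ?_ + ?_ + ?_
  · rw [add_assoc]; exact le_self_add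
  · rw [add_assoc, add_left_comm]; exact le_self_add
  · exact le_add_self

theorem exists_modulus_le (d r : ℕ) (hr : 1 ≤ r) :
    ∃ M : ℝ≥0, ∀ f : EuclideanSpace ℝ (Fin d) → ℝ, ContinuousOn f (unitCube d) →
      ∀ (n n₀ : ℤ), IsGreatest {m : ℤ | (r : ℝ) * (2 : ℝ) ^ (m - n - 1) ≤ 1} n₀ →
      ∀ t : ℝ, (2 : ℝ) ^ (-n - 1) < t → t ≤ (2 : ℝ) ^ (-n) →
        modulus r f t
          ≤ (M : ℝ≥0∞) *
            ((∑' k : ℕ, discreteModulus r f (n + (k : ℤ)))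
              + (∑ k ∈ Finset.Icc (1 : ℤ) n₀,
                  (2 : ℝ≥0∞) ^ (-(k * (r : ℤ))) * discreteModulus r f (n - k))
              + ENNReal.ofReal (t ^ r) * cubeNorm f) := by
  obtain ⟨C, hC⟩ := exists_enorm_rDiff_le d r hr
  refine ⟨2 * C + (4 * r) ^ r, fun f hf n n₀ hn₀ t ht1 ht2 =>
    iSup₂_le fun h hh => iSup₂_le fun x hx => iSup_le fun hxh => ?_⟩
  have hr' : (1 : ℝ) ≤ r := by exact_mod_cast hr
  have ht0 : 0 < t := lt_trans (by positivity) ht1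
  -- Maximality of `n₀` says that `n - n₀ + 1` is the least exponent `m` with r ≤ 2^m, so 2^m < 2r.
  have hmem : (r : ℝ) ≤ 2 ^ (n - n₀ + 1) := by
    have := hn₀.1
    rw [Set.mem_ofPred_eq, show n₀ - n - 1 = -(n - n₀ + 1) by ring, zpow_neg, ← div_eq_mul_inv,
      div_le_one (by positivity)] at this
    exact this
  have hnot : (2 : ℝ) ^ (n - n₀ + 1) < 2 * r := by
    have h1 : n₀ + 1 ∉ {m : ℤ | (r : ℝ) * (2 : ℝ) ^ (m - n - 1) ≤ 1} := fun h => by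
      have := hn₀.2 h
      omega
    rw [Set.mem_ofPred_eq, not_le, show n₀ + 1 - n - 1 = -(n - n₀) by ring, zpow_neg,
      ← div_eq_mul_inv, one_lt_div (by positivity)] at h1
    rw [zpow_add_one₀ (by norm_num)]
    linarith
  have hnonneg : 0 ≤ n - n₀ + 1 := by
    by_contra! h
    exact absurd (hr'.trans hmem) (not_le.2 (zpow_lt_one_of_neg₀ (by norm_num) h))
  obtain ⟨m, hm⟩ := Int.eq_ofNat_of_zero_le hnonneg
  rw [hm, zpow_natCast] at hmem hnot
  rcases le_or_gt (m : ℤ) n with hmn | hmn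
  · obtain ⟨L, hL⟩ := Int.le.dest hmn
    have hn : n = ((m + L : ℕ) : ℤ) := by rw [← hL]; push_cast; rfl
    refine (hC f hf m L (by exact_mod_cast hmem) (by exact_mod_cast hnot.le) t ht0 (hn ▸ ht2)
      x h hx hxh hh).trans ?_
    rw [← hn]
    set F : ℤ → ℝ≥0∞ := fun k => (2 : ℝ≥0∞) ^ (-(k * (r : ℤ))) * discreteModulus r f (n - k)
      with hF
    -- Here L = n₀ - 1. The term `s = 0` is the first term of the tail, whose double use explains
    -- the factor 2 in the constant.
    have hsum : ∑ s ∈ Finset.range L, F (s : ℤ)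
        ≤ (∑' k : ℕ, discreteModulus r f (n + k)) + ∑ k ∈ Finset.Icc (1 : ℤ) n₀, F k := by
      calc ∑ s ∈ Finset.range L, F (s : ℤ)
          = ∑ k ∈ (Finset.range L).map Nat.castEmbedding, F k := by simp
        _ ≤ ∑ k ∈ insert 0 (Finset.Icc (1 : ℤ) n₀), F k := by
            refine Finset.sum_le_sum_of_subset fun k hk => ?_
            simp only [Finset.mem_map, Finset.mem_range, Nat.castEmbedding_apply,
              Finset.mem_insert, Finset.mem_Icc] at hk ⊢
            omega
        _ = F 0 + ∑ k ∈ Finset.Icc (1 : ℤ) n₀, F k := Finset.sum_insert (by simp)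
        _ ≤ _ := by
            gcongr
            have := ENNReal.le_tsum (f := fun k : ℕ => discreteModulus r f (n + k)) 0
            simpa [hF] using this
    have hle : (2 : ℝ≥0∞) * C ≤ ((2 * C + (4 * r) ^ r : ℝ≥0) : ℝ≥0∞) := by
      push_cast; exact le_self_add
    refine le_trans ?_ (mul_le_mul_left hle _)
    rw [mul_comm 2, mul_assoc]
    refine mul_le_mul_right ?_ _
    rw [two_mul]
    refine (add_le_add_left (add_le_add_right hsum _) _).trans ?_
    set S := ∑' k : ℕ, discreteModulus r f (n + k)
    set T := ∑ k ∈ Finset.Icc (1 : ℤ) n₀, F k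
    set U := ENNReal.ofReal (t ^ r) * cubeNorm f
    calc S + (S + T) + U = S + (S + T + U) := by ring
      _ ≤ (S + T + U) + (S + T + U) := by
        gcongr
        rw [add_assoc]; exact le_self_add
  -- In the case n₀ ≤ 0, `t` is bounded below by 1/(2r), so the trivial bound 2^r‖f‖ is already at
  -- most (4r)^r t^r‖f‖.
  · have h1 : 1 ≤ 2 * r * t := by
      have h2 : (2 : ℝ) ^ (-(m : ℤ)) ≤ 2 ^ (-n - 1) :=
        zpow_le_zpow_right₀ (by norm_num) (by omega)
      have h3 := h2.trans ht1.le
      rw [zpow_neg, zpow_natCast, inv_le_iff_one_le_mul₀ (by positivity)] at h3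
      nlinarith
    have h2 : |rDiff r h f x| ≤ (4 * r) ^ r * (t ^ r * (cubeNorm f).toReal) := by
      refine (abs_rDiff_le_cubeNorm hf hx hxh).trans ?_
      have h3 : (2 : ℝ) ^ r ≤ (4 * r) ^ r * t ^ r := by
        rw [← mul_pow]
        exact pow_le_pow_left₀ (by norm_num) (by linarith) _
      rw [← mul_assoc]
      exact mul_le_mul_of_nonneg_right h3 ENNReal.toReal_nonneg
    rw [Real.enorm_eq_ofReal_abs]
    refine (ENNReal.ofReal_le_ofReal h2).trans ?_
    rw [ENNReal.ofReal_mul (by positivity), ENNReal.ofReal_mul (by positivity),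
      ENNReal.ofReal_toReal (cubeNorm_ne_top hf)]
    refine mul_le_mul' ?_ le_add_self
    rw [ENNReal.ofReal_pow (by positivity), ENNReal.ofReal_mul (by norm_num)]
    push_cast
    simp

theorem theorem1p1 (d : ℕ) :
    (∀ r : ℕ, 1 ≤ r →
      (∃ M₁ : ℝ≥0, ∀ f : EuclideanSpace ℝ (Fin d) → ℝ, ContinuousOn f (unitCube d) →
        ∀ (n : ℤ) (t : ℝ), 0 ≤ t → t ≤ (2 : ℝ) ^ (-n) →
        ∀ (i : Fin d) (u : EuclideanSpace ℝ (Fin d)),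
          u ∈ unitCube d → u + ((r : ℝ) * t) • axis i ∈ unitCube d →
          ‖rDiff r (t • axis i) f u‖ₑ
            ≤ (M₁ : ℝ≥0∞) * ∑' k : ℕ, discreteModulus r f (n + (k : ℤ))) ∧
      (∃ M₂ : ℝ≥0, ∀ f : EuclideanSpace ℝ (Fin d) → ℝ, ContinuousOn f (unitCube d) →
        ∀ (n n₀ : ℤ), IsGreatest {m : ℤ | (r : ℝ) * (2 : ℝ) ^ (m - n - 1) ≤ 1} n₀ →
        ∀ t : ℝ, (2 : ℝ) ^ (-n - 1) < t → t ≤ (2 : ℝ) ^ (-n) →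
          modulus r f t
            ≤ (M₂ : ℝ≥0∞) *
              ((∑' k : ℕ, discreteModulus r f (n + (k : ℤ)))
                + (∑ k ∈ Finset.Icc (1 : ℤ) n₀,
                    (2 : ℝ≥0∞) ^ (-(k * (r : ℤ))) * discreteModulus r f (n - k))
                + ENNReal.ofReal (t ^ r) * cubeNorm f))) ∧
    (∃ M : ℝ≥0, ∀ f : EuclideanSpace ℝ (Fin d) → ℝ, ContinuousOn f (unitCube d) →
      ∀ (n : ℤ) (t : ℝ), 0 ≤ t → t ≤ (2 : ℝ) ^ (-n) →
        modulus 1 f t ≤ (M : ℝ≥0∞) * ∑' k : ℕ, discreteModulus 1 f (n + (k : ℤ))) :=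
  ⟨fun r hr => ⟨exists_enorm_rDiff_axis_le d r hr, exists_modulus_le d r hr⟩,
    exists_modulus_one_le d⟩
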